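/- Let $V$ be an $n$-dimensional complex vector space, endowed with a nondegenerate hermitian form $h:V\times V\to\mathbb{C}$ (that is, $h$ is biadditive, $h(\alpha v,w)=\alpha h(v,w)$ and $h(v,w)=\overline{h(w,v)}$ for all $\alpha\in\mathbb{C}$, $v,w\in V$; $h$ need not be definite). Let $U(V,h)=\{g\in GL_{\mathbb{C}}(V): h(gv,gw)=h(v,w)\ \forall v,w\in V\}$, let $J:V\to V$ be multiplication by $i$, and let $\langle v\mid w\rangle=\operatorname{Re}h(v,w)$. For $r\in\mathbb{N}$, call an $\mathbb{R}$-multilinear map $f:V\times\stackrel{r}{\cdots}\times V\to\mathbb{R}$ invariant if $f(gv_1,\ldots,gv_r)=f(v_1,\ldots,v_r)$ for all $g\in U(V,h)$ and $v_1,\ldots,v_r\in V$. If there is a nonzero invariant multilinear map $f:V\times\stackrel{r}{\cdots}\times V\to\mathbb{R}$, then $r$ is even. Moreover, for $r=2m$, the maps $$(v_1,\ldots,v_{2m})\mapsto\prod_{l=1}^m\left\langle v_{\sigma(2l-1)}\mid J^{\delta_l}v_{\sigma(2l)}\right\rangle,$$ where $\sigma\in S_{2m}$ (the symmetric group on $\{1,\ldots,2m\}$)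 and $\delta_1,\ldots,\delta_m\in\{0,1\}$, are invariant multilinear maps, and every invariant multilinear map $f:V\times\stackrel{2m}{\cdots}\times V\to\mathbb{R}$ is a linear combination of them with real coefficients. -/

import Mathlib

open scoped ComplexConjugate

noncomputable section

namespace UnitaryInvariants

variable {V : Type*} [AddCommGroup V] [Module ℂ V]

/-- The unitary group `U(V, h)` of a sesquilinear form `h` (linear in the first variable): the
complex-linear automorphisms `g` of `V` with `h (g v) (g w) = h v w` for all `v`, `w`. -/
def unitaryGroup (h : V →ₗ[ℂ] V →ₗ⋆[ℂ] ℂ) : Subgroup (V ≃ₗ[ℂ] V) where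
  carrier := {g | ∀ v w, h (g v) (g w) = h v w}
  one_mem' := fun _ _ => rfl
  mul_mem' := by
    intro a b ha hb v w
    rw [LinearEquiv.mul_apply, LinearEquiv.mul_apply, ha, hb]
  inv_mem' := by
    intro g hg v w
    rw [← hg (g⁻¹ v) (g⁻¹ w), ← LinearEquiv.mul_apply, ← LinearEquiv.mul_apply, mul_inv_cancel]
    rfl

/-- The real vector space of real-multilinear `U(V, h)`-invariant maps `V × ⋯ × V → ℝ`
(with `r` factors). -/
def invariantForms (h : V →ₗ[ℂ] V →ₗ⋆[ℂ] ℂ) (r : ℕ) :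
    Submodule ℝ (MultilinearMap ℝ (fun _ : Fin r => V) ℝ) where
  carrier := {f | ∀ g ∈ unitaryGroup h, ∀ v : Fin r → V, f (fun i => g (v i)) = f v}
  zero_mem' := fun _ _ _ => rfl
  add_mem' := by
    intro f₁ f₂ h₁ h₂ g hg v
    simp only [add_apply, h₁ g hg v, h₂ g hg v]
  smul_mem' := by
    intro c f hf g hg v
    simp only [smul_apply, hf g hg v]

/-- The real bilinear form `⟨v | w⟩ = Re (h v w)`. -/
def realForm (h : V →ₗ[ℂ] V →ₗ⋆[ℂ] ℂ) : V →ₗ[ℝ] V →ₗ[ℝ] ℝ :=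
  LinearMap.mk₂ ℝ (fun v w => (h v w).re)
    (by intros; simp)
    (by intro c v w; rw [← Complex.coe_smul c v]; simp)
    (by intros; simp)
    (by intro c v w; rw [← Complex.coe_smul c w, map_smulₛₗ]; simp)

variable (V) in
/-- Multiplication by the imaginary unit, as a real-linear endomorphism of `V`. -/
def J : Module.End ℝ V where
  toFun v := Complex.I • v
  map_add' := smul_add _
  map_smul' c v := smul_comm Complex.I c v

/-- The function
`(v_1, …, v_{2m}) ↦ ∏_{l = 1}^m ⟨v_{σ (2l - 1)} | J ^ δ_l v_{σ (2l)}⟩`.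
Indices are shifted to start from `0`, so that the pair `(2l - 1, 2l)` becomes `(2l, 2l + 1)`. -/
def pairingProductFun (h : V →ₗ[ℂ] V →ₗ⋆[ℂ] ℂ) {m : ℕ} (σ : Equiv.Perm (Fin (2 * m)))
    (δ : Fin m → Fin 2) (v : Fin (2 * m) → V) : ℝ :=
  ∏ l : Fin m, realForm h (v (σ ⟨2 * l.1, by omega⟩))
    ((J V ^ (δ l).1) (v (σ ⟨2 * l.1 + 1, by omega⟩)))

/-- As a function of a single argument, `pairingProductFun` is linear. -/
theorem pairingProductFun_update (h : V →ₗ[ℂ] V →ₗ⋆[ℂ] ℂ) {m : ℕ}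
    (σ : Equiv.Perm (Fin (2 * m))) (δ : Fin m → Fin 2) (v : Fin (2 * m) → V)
    (i : Fin (2 * m)) :
    ∃ φ : V →ₗ[ℝ] ℝ, ∀ x, pairingProductFun h σ δ (Function.update v i x) = φ x := by
  obtain ⟨k, rfl⟩ := σ.surjective i
  have hk := k.2
  set l₀ : Fin m := ⟨k.1 / 2, by omega⟩ with hl₀
  set c : ℝ := ∏ l ∈ Finset.univ.erase l₀, realForm h (v (σ ⟨2 * l.1, by omega⟩))
    ((J V ^ (δ l).1) (v (σ ⟨2 * l.1 + 1, by omega⟩))) with hc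
  have hrest : ∀ x, ∏ l ∈ Finset.univ.erase l₀,
      realForm h (Function.update v (σ k) x (σ ⟨2 * l.1, by omega⟩))
      ((J V ^ (δ l).1) (Function.update v (σ k) x (σ ⟨2 * l.1 + 1, by omega⟩))) = c := by
    intro x
    refine Finset.prod_congr rfl fun l hl => ?_
    have hne : l.1 ≠ k.1 / 2 := fun hh => (Finset.mem_erase.1 hl).1 (Fin.ext hh)
    rw [Function.update_of_ne, Function.update_of_ne]
    · intro hh
      have := congrArg Fin.val (σ.injective hh)
      simp only at this
      omega
    · intro hh
      have := congrArg Fin.val (σ.injective hh)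
      simp only at this
      omega
  rcases Nat.mod_two_eq_zero_or_one k.1 with hp | hp
  · have h0 : (⟨2 * l₀.1, by omega⟩ : Fin (2 * m)) = k := Fin.ext (by simp only [hl₀]; omega)
    have h1 : σ (⟨2 * l₀.1 + 1, by omega⟩ : Fin (2 * m)) ≠ σ k := fun hh => by
      have := congrArg Fin.val (σ.injective hh)
      simp only [hl₀] at this
      omega
    refine ⟨c • (realForm h).flip ((J V ^ (δ l₀).1) (v (σ ⟨2 * l₀.1 + 1, by omega⟩))), ?_⟩
    intro x
    rw [pairingProductFun, ← Finset.mul_prod_erase _ _ (Finset.mem_univ l₀), hrest, h0,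
      Function.update_self, Function.update_of_ne h1, mul_comm]
    rfl
  · have h0 : (⟨2 * l₀.1 + 1, by omega⟩ : Fin (2 * m)) = k := Fin.ext (by simp only [hl₀]; omega)
    have h1 : σ (⟨2 * l₀.1, by omega⟩ : Fin (2 * m)) ≠ σ k := fun hh => by
      have := congrArg Fin.val (σ.injective hh)
      simp only [hl₀] at this
      omega
    refine ⟨c • (realForm h (v (σ ⟨2 * l₀.1, by omega⟩))).comp (J V ^ (δ l₀).1), ?_⟩
    intro x
    rw [pairingProductFun, ← Finset.mul_prod_erase _ _ (Finset.mem_univ l₀), hrest, h0,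
      Function.update_self, Function.update_of_ne h1, mul_comm]
    rfl

/-- The function `pairingProductFun h σ δ` as a real-multilinear map. -/
def pairingProduct (h : V →ₗ[ℂ] V →ₗ⋆[ℂ] ℂ) {m : ℕ} (σ : Equiv.Perm (Fin (2 * m)))
    (δ : Fin m → Fin 2) : MultilinearMap ℝ (fun _ : Fin (2 * m) => V) ℝ where
  toFun := pairingProductFun h σ δ
  map_update_add' := by
    intro _ v i x y
    obtain ⟨φ, hφ⟩ := pairingProductFun_update h σ δ v i
    convert map_add φ x y <;> rw [← hφ] <;> congr!
  map_update_smul' := by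
    intro _ v i c x
    obtain ⟨φ, hφ⟩ := pairingProductFun_update h σ δ v i
    convert map_smul φ c x <;> rw [← hφ] <;> congr!

theorem pairingProduct_apply (h : V →ₗ[ℂ] V →ₗ⋆[ℂ] ℂ) {m : ℕ} (σ : Equiv.Perm (Fin (2 * m)))
    (δ : Fin m → Fin 2) (v : Fin (2 * m) → V) :
    pairingProduct h σ δ v = ∏ l : Fin m, realForm h (v (σ ⟨2 * l.1, by omega⟩))
      ((J V ^ (δ l).1) (v (σ ⟨2 * l.1 + 1, by omega⟩))) := rfl

end UnitaryInvariants

end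

/-! The scalar −1 is unitary, so an invariant map of odd degree equals its own negative. For r = 2m,
regard f as complex-valued and split it, slot by slot, into invariant parts that are complex-linear
or conjugate-linear in each argument. On a nonzero part with p linear and q conjugate-linear slots,
unitary scalars z give z^p z̄^q = 1, which forces p = q = m (`card_linear_eq_card_conjLinear`).

In a basis and its dual family, such a part F is a matrix T on the m-th tensor power, and invariance
says that T commutes with g^⊗m for unitary g. Both products are homogeneous polynomials in the
entries of g, and the unitary group is Zariski dense (`eq_zero_of_forall_unitary_eval_eq_zero`), so
T commutes with the tensor power of the generic matrix. Schur–Weyl duality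
(`exists_eq_sum_perm_of_commute_tensorPower`) makes T a combination of permutations of the tensor
factors, and F a combination of products of values of h (`exists_eq_sum_prod_form`). Expanding h(v,
w) = ⟨v | w⟩ + i⟨v | Jw⟩ and taking real parts yields the pairing products. -/

noncomputable section

namespace UnitaryInvariants

open Matrix

variable {V : Type*} [AddCommGroup V] [Module ℂ V]

/-! ### Zariski density of the unitary group, via the Cayley transform. -/

section Density

variable {n : Type*} [Fintype n] [DecidableEq n]

/-- The Cayley transform of a matrix that is skew-adjoint for `H` is unitary for `H`. -/
theorem cayley_mem_unitary {H X : Matrix n n ℂ} (hX : Xᴴ * H = -(H * X))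
    (hdet : IsUnit (1 - X).det) :
    ((1 + X) * (1 - X)⁻¹)ᴴ * H * ((1 + X) * (1 - X)⁻¹) = H := by
  -- The terms linear in X cancel: both sides are H + XᴴHX.
  have key : (1 + X)ᴴ * H * (1 + X) = (1 - X)ᴴ * H * (1 - X) := by
    simp only [conjTranspose_add, conjTranspose_sub, conjTranspose_one, add_mul, sub_mul, hX,
      one_mul, mul_add, mul_sub, mul_one, neg_mul]
    abel
  have h1 : (1 - X) * (1 - X)⁻¹ = 1 := mul_nonsing_inv _ hdet
  have h2 : ((1 - X)⁻¹)ᴴ * (1 - X)ᴴ = 1 := by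
    rw [← conjTranspose_mul, h1, conjTranspose_one]
  calc ((1 + X) * (1 - X)⁻¹)ᴴ * H * ((1 + X) * (1 - X)⁻¹)
      = ((1 - X)⁻¹)ᴴ * ((1 + X)ᴴ * H * (1 + X)) * (1 - X)⁻¹ := by
        rw [conjTranspose_mul]; noncomm_ring
    _ = (((1 - X)⁻¹)ᴴ * (1 - X)ᴴ) * H * ((1 - X) * (1 - X)⁻¹) := by
        rw [key]; noncomm_ring
    _ = H := by rw [h1, h2]; simp

/-- Every matrix is a complex combination of two matrices that are skew-adjoint for `H`. -/
theorem exists_skewAdjoint_decomposition {H : Matrix n n ℂ} (hH : H.IsHermitian)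
    (hdet : IsUnit H.det) (X : Matrix n n ℂ) :
    ∃ K L : Matrix n n ℂ, Kᴴ * H = -(H * K) ∧ Lᴴ * H = -(H * L) ∧ X = K + Complex.I • L := by
  have hHH : H * H⁻¹ = 1 := mul_nonsing_inv _ hdet
  have hHH' : H⁻¹ * H = 1 := nonsing_inv_mul _ hdet
  have hinv : (H⁻¹)ᴴ = H⁻¹ := hH.inv.eq
  -- Y is the adjoint of X for H. The self-adjoint part (X + Y) / 2 is i times a skew-adjoint
  -- matrix.
  obtain ⟨Y, hY⟩ : ∃ Y, Y = H⁻¹ * Xᴴ * H := ⟨_, rfl⟩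
  have hHY : H * Y = Xᴴ * H := by rw [hY, ← mul_assoc, ← mul_assoc, hHH, one_mul]
  have hYH : Yᴴ * H = H * X := by
    rw [hY, conjTranspose_mul, conjTranspose_mul, conjTranspose_conjTranspose, hinv, hH.eq,
      mul_assoc, mul_assoc, hHH', mul_one]
  refine ⟨(1 / 2 : ℂ) • (X - Y), (-Complex.I / 2 : ℂ) • (X + Y), ?_, ?_, ?_⟩
  · rw [conjTranspose_smul, conjTranspose_sub, smul_mul, Matrix.mul_smul, sub_mul, mul_sub, hHY, hYH,
      ← smul_neg]
    simp
  · rw [conjTranspose_smul, conjTranspose_add, smul_mul, Matrix.mul_smul, add_mul, mul_add, hHY, hYH,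
      ← neg_smul, add_comm]
    congr 1
    simp [neg_div]
  · rw [smul_smul]
    have : Complex.I * (-Complex.I / 2) = 1 / 2 := by
      rw [mul_div_assoc', mul_neg, Complex.I_mul_I, neg_neg]
    rw [this, ← smul_add]
    ext i j
    simp
    ring

/-- The unitary group of a nondegenerate hermitian form is Zariski dense: a homogeneous polynomial
in the matrix entries that vanishes on it is zero. -/
theorem eq_zero_of_forall_unitary_eval_eq_zero {H : Matrix n n ℂ} (hH : H.IsHermitian)
    (hdet : IsUnit H.det) {p : MvPolynomial (n × n) ℂ} {d : ℕ} (hp : p.IsHomogeneous d)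
    (hvan : ∀ g : Matrix n n ℂ, gᴴ * H * g = H →
      MvPolynomial.eval (fun ij => g ij.1 ij.2) p = 0) : p = 0 := by
  -- Homogeneity absorbs the scalar by which the adjugate, polynomial in the entries, differs from
  -- the inverse.
  have hscale : ∀ (c : ℂ) (A : Matrix n n ℂ),
      MvPolynomial.eval (fun ij => (c • A) ij.1 ij.2) p =
        c ^ d * MvPolynomial.eval (fun ij => A ij.1 ij.2) p := fun c A => by
    rw [MvPolynomial.eval_eq, MvPolynomial.eval_eq, Finset.mul_sum]
    refine Finset.sum_congr rfl fun m hm => ?_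
    have hdeg : ∑ i ∈ m.support, m i = d := by
      rw [← hp.degree_eq_sum_deg_support hm]
    simp only [Matrix.smul_apply, smul_eq_mul, mul_pow, Finset.prod_mul_distrib,
      Finset.prod_pow_eq_pow_sum, hdeg]
    ring
  have hadj : ∀ A : Matrix n n ℂ, IsUnit A.det → A.adjugate = A.det • A⁻¹ := fun A hA => by
    rw [inv_def, smul_smul, Ring.mul_inverse_cancel _ hA, one_smul]
  -- vanishing on the image of the Cayley transform
  have hcay : ∀ X : Matrix n n ℂ, IsUnit (1 - X).det →
      MvPolynomial.eval (fun ij => ((1 + X) * (1 - X)⁻¹) ij.1 ij.2) p = 0 := by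
    intro X hX
    obtain ⟨K, L, hK, hL, rfl⟩ := exists_skewAdjoint_decomposition hH hdet X
    -- The complex line s ↦ K + sL is skew-adjoint at real s and passes through the given matrix at
    -- s = i. The factor det(1 − Z) makes Q vanish also at the real s where the Cayley transform is
    -- undefined; Q then has infinitely many roots.
    let Z : Matrix n n (Polynomial ℂ) := K.map Polynomial.C + (Polynomial.X : Polynomial ℂ) • L.map Polynomial.C
    let Q : Polynomial ℂ :=
      MvPolynomial.aeval (fun ij => ((1 + Z) * (1 - Z).adjugate) ij.1 ij.2) p * (1 - Z).det
    have hZ : ∀ s : ℂ, (Polynomial.evalRingHom s).mapMatrix Z = K + s • L := fun s => by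
      ext i j
      simp [Z]
      ring
    have hQ : ∀ s : ℂ, Q.eval s =
        MvPolynomial.eval (fun ij => ((1 + (K + s • L)) * (1 - (K + s • L)).adjugate) ij.1 ij.2) p *
          (1 - (K + s • L)).det := by
      intro s
      rw [← Polynomial.coe_evalRingHom, map_mul, RingHom.map_det, map_sub, map_one, hZ]
      congr 1
      rw [MvPolynomial.aeval_def, MvPolynomial.hom_eval₂, MvPolynomial.eval, MvPolynomial.coe_eval₂Hom]
      congr 1
      · ext x; simp
      · funext ij
        rw [← hZ, ← map_one (Polynomial.evalRingHom s).mapMatrix, ← map_sub, ← map_add,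
          ← RingHom.map_adjugate, ← map_mul]
        rfl
    have hQ0 : Q = 0 := by
      refine Polynomial.eq_zero_of_infinite_isRoot Q
        (Set.Infinite.mono ?_ (Set.infinite_range_of_injective Complex.ofReal_injective))
      rintro _ ⟨t, rfl⟩
      rw [Set.mem_ofPred_eq, Polynomial.IsRoot, hQ]
      by_cases hu : (1 - (K + (t : ℂ) • L)).det = 0
      · rw [hu, mul_zero]
      have hu' := isUnit_iff_ne_zero.2 hu
      have hskew : (K + (t : ℂ) • L)ᴴ * H = -(H * (K + (t : ℂ) • L)) := by
        rw [conjTranspose_add, conjTranspose_smul, add_mul, smul_mul, hK, hL, mul_add, Matrix.mul_smul]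
        simp
        abel
      rw [hadj _ hu', Matrix.mul_smul, hscale, hvan _ (cayley_mem_unitary hskew hu'), mul_zero, zero_mul]
    have := hQ Complex.I
    rw [hQ0, Polynomial.eval_zero, hadj _ hX, Matrix.mul_smul, hscale] at this
    have hne := isUnit_iff_ne_zero.1 hX
    simpa [hne] using this.symm
  -- Y is the Cayley transform of (Y − 1)(1 + Y)⁻¹ as soon as 1 + Y is invertible.
  have hY : ∀ Y : Matrix n n ℂ, IsUnit (1 + Y).det →
      MvPolynomial.eval (fun ij => Y ij.1 ij.2) p = 0 := by
    intro Y hY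
    have e1 : (1 + Y) * (1 + Y)⁻¹ = 1 := mul_nonsing_inv _ hY
    have e2 : 1 - (Y - 1) * (1 + Y)⁻¹ = (2 : ℂ) • (1 + Y)⁻¹ := by
      nth_rewrite 1 [← e1]
      rw [add_mul, sub_mul, one_mul, two_smul]
      abel
    have e3 : 1 + (Y - 1) * (1 + Y)⁻¹ = Y * ((2 : ℂ) • (1 + Y)⁻¹) := by
      nth_rewrite 1 [← e1]
      rw [add_mul, sub_mul, one_mul, two_smul, mul_add]
      abel
    have hu : IsUnit ((2 : ℂ) • (1 + Y)⁻¹).det := by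
      rw [det_smul]
      exact (IsUnit.pow _ (isUnit_iff_ne_zero.2 two_ne_zero)).mul (isUnit_nonsing_inv_det _ hY)
    have := hcay ((Y - 1) * (1 + Y)⁻¹) (by rw [e2]; exact hu)
    rwa [e2, e3, mul_assoc, mul_nonsing_inv _ hu, mul_one] at this
  -- The condition det(1 + Y) ≠ 0 is removed by multiplying p by this nonzero polynomial, in a
  -- domain.
  let D : MvPolynomial (n × n) ℂ := (1 + mvPolynomialX n n ℂ).det
  have hD : ∀ Y : n × n → ℂ, MvPolynomial.eval Y D = (1 + Matrix.of fun i j => Y (i, j)).det := by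
    intro Y
    simp only [D]
    rw [RingHom.map_det, map_add, map_one]
    congr 2
    ext i j
    simp
  have hD0 : D ≠ 0 := fun h0 => by
    have := hD 0
    rw [h0, map_zero] at this
    have h1 : (1 + Matrix.of fun i j => (0 : n × n → ℂ) (i, j)) = (1 : Matrix n n ℂ) := by
      ext; simp
    rw [h1, det_one] at this
    exact zero_ne_one this
  have : p * D = 0 := by
    refine MvPolynomial.funext fun Y => ?_
    rw [map_mul, hD, map_zero]
    by_cases hu : (1 + Matrix.of fun i j => Y (i, j)).det = 0
    · rw [hu, mul_zero]
    · have := hY _ (isUnit_iff_ne_zero.2 hu)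
      simp only [of_apply] at this
      rw [this, zero_mul]
  exact (mul_eq_zero.1 this).resolve_right hD0

end Density

/-! ### The double centralizer theorem for permutation matrices. -/

section DoubleCentralizer

variable {G K : Type*} [Group G] [Fintype G] [Fintype K] [DecidableEq K] [MulAction G K]

/-- The double centralizer theorem for a finite permutation group: a matrix that commutes with
every invariant matrix is a combination of permutation matrices. -/
theorem exists_eq_sum_permutation (T : Matrix K K ℂ)
    (hT : ∀ B : Matrix K K ℂ, (∀ (g : G) I J, B (g • I) (g • J) = B I J) → T * B = B * T) :
    ∃ c : G → ℂ, ∀ I J, T I J = ∑ g, c g * if I = g • J then 1 else 0 := by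
  let P : G → Matrix K K ℂ := fun g => Matrix.of fun I J => if I = g • J then 1 else 0
  let A : Submodule ℂ (Matrix K K ℂ) := Submodule.span ℂ (Set.range P)
  let act : G → Matrix K K ℂ →ₗ[ℂ] Matrix K K ℂ := fun g =>
    { toFun := fun Z => Matrix.of fun I J => Z (g⁻¹ • I) J
      map_add' := fun _ _ => rfl
      map_smul' := fun _ _ => rfl }
  have act_apply : ∀ g Z I J, act g Z I J = Z (g⁻¹ • I) J := fun _ _ _ _ => rfl
  have act_mul : ∀ g k Z, act g (act k Z) = act (g * k) Z := fun g k Z => by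
    ext I J
    simp [act_apply, mul_smul]
  have act_one : ∀ Z, act 1 Z = Z := fun Z => by ext I J; simp [act_apply]
  have act_P : ∀ g k, act g (P k) = P (g * k) := fun g k => by
    ext I J
    simp [act_apply, P, mul_smul, inv_smul_eq_iff]
  have act_mem : ∀ g Z, Z ∈ A → act g Z ∈ A := fun g Z hZ => by
    have hle : A ≤ A.comap (act g) := Submodule.span_le.2 (by
      rintro _ ⟨k, rfl⟩
      exact Submodule.subset_span ⟨g * k, (act_P g k).symm⟩)
    exact hle hZ
  obtain ⟨π, hπ⟩ := A.subtype.exists_leftInverse_of_injective (Submodule.ker_subtype A)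
  have hπ' : ∀ Z (hZ : Z ∈ A), (π Z : Matrix K K ℂ) = Z := fun Z hZ =>
    congrArg Subtype.val (LinearMap.congr_fun hπ ⟨Z, hZ⟩)
  -- an equivariant projection onto the span of the permutation matrices
  let E : Matrix K K ℂ →ₗ[ℂ] Matrix K K ℂ :=
    (Fintype.card G : ℂ)⁻¹ • ∑ g : G, act g ∘ₗ A.subtype ∘ₗ π ∘ₗ act g⁻¹
  have E_apply : ∀ Z, E Z = (Fintype.card G : ℂ)⁻¹ • ∑ g : G, act g (π (act g⁻¹ Z)) := fun Z => by
    simp [E]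
  have hcard : (Fintype.card G : ℂ) ≠ 0 := Nat.cast_ne_zero.2 Fintype.card_ne_zero
  have E_mem : ∀ Z, E Z ∈ A := fun Z => by
    rw [E_apply]
    exact A.smul_mem _ (A.sum_mem fun g _ => act_mem _ _ (π _).2)
  have E_id : ∀ Z ∈ A, E Z = Z := fun Z hZ => by
    have : ∀ g : G, act g (π (act g⁻¹ Z)) = Z := fun g => by
      rw [hπ' _ (act_mem _ _ hZ), act_mul, mul_inv_cancel, act_one]
    rw [E_apply, Finset.sum_congr rfl fun g _ => this g, Finset.sum_const, Finset.card_univ,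
      ← Nat.cast_smul_eq_nsmul ℂ, smul_smul, inv_mul_cancel₀ hcard, one_smul]
  have E_act : ∀ k Z, E (act k Z) = act k (E Z) := fun k Z => by
    rw [E_apply, E_apply, map_smul, map_sum]
    congr 1
    refine Fintype.sum_equiv (Equiv.mulLeft k⁻¹) _ _ fun g => ?_
    simp [act_mul]
  -- `B c d` is the block of E that sends column d to column c. Equivariance of E makes it an
  -- invariant matrix, so T commutes with every block.
  let B : K → K → Matrix K K ℂ := fun c d => Matrix.of fun I J => E (single J d 1) I c
  have hB : ∀ c d (g : G) I J, B c d (g • I) (g • J) = B c d I J := fun c d g I J => by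
    have : single (g • J) d (1 : ℂ) = act g (single J d 1) := by
      ext I' J'
      simp [act_apply, single_apply, eq_inv_smul_iff]
    simp only [B, of_apply]
    rw [this, E_act, act_apply, inv_smul_smul]
  have E_expand : ∀ Z I c, E Z I c = ∑ d, (B c d * Z) I d := fun Z I c => by
    conv_lhs => rw [matrix_eq_sum_single Z]
    simp only [map_sum, Matrix.sum_apply, mul_apply, B, of_apply]
    rw [Finset.sum_comm]
    refine Finset.sum_congr rfl fun d _ => Finset.sum_congr rfl fun J _ => ?_
    rw [← mul_one (Z J d), ← smul_eq_mul, ← smul_single, map_smul]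
    simp [mul_comm]
  -- By the block commutation, E commutes with left multiplication by T. As E fixes 1, it follows
  -- that T = E T lies in the span.
  have E_comm : E T = T * E 1 := by
    ext I c
    rw [E_expand, mul_apply]
    simp only [E_expand, Finset.mul_sum]
    rw [Finset.sum_comm]
    refine Finset.sum_congr rfl fun d _ => ?_
    rw [← hT _ (hB c d), mul_apply]
    simp
  have one_mem : (1 : Matrix K K ℂ) ∈ A := Submodule.subset_span ⟨1, by
    ext I J
    simp [P, one_apply]⟩
  have hTA : T ∈ A := by
    rw [E_id 1 one_mem, mul_one] at E_comm
    rw [← E_comm]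
    exact E_mem T
  obtain ⟨c, hc⟩ := (Submodule.mem_span_range_iff_exists_fun ℂ).1 hTA
  refine ⟨c, fun I J => ?_⟩
  rw [← hc]
  simp [Matrix.sum_apply, P]

end DoubleCentralizer

/-! ### Schur–Weyl duality for the generic matrix. -/

section TensorPower

variable {ι n : Type*} [Fintype ι]

/-- Two families of indices of the same type differ by a permutation. -/
theorem exists_perm_of_sum_single_eq {α : Type*} {u v : ι → α}
    (h : ∑ j, Finsupp.single (u j) 1 = ∑ j, Finsupp.single (v j) 1) :
    ∃ σ : Equiv.Perm ι, v = u ∘ σ := by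
  classical
  have hcard : ∀ (w : ι → α) (a : α),
      (∑ j, Finsupp.single (w j) 1 : α →₀ ℕ) a = Fintype.card {j // w j = a} := fun w a => by
    rw [Finsupp.finsetSum_apply, Fintype.card_subtype, Finset.card_filter]
    simp [Finsupp.single_apply]
  -- The sums count fibres, so fibres over the same point have equal size and can be matched.
  have e : ∀ a, Nonempty ({j // v j = a} ≃ {j // u j = a}) := fun a =>
    Fintype.card_eq.1 (by rw [← hcard, ← hcard, h])
  exact ⟨Equiv.ofFiberEquiv fun a => (e a).some, funext fun j => (Equiv.ofFiberEquiv_map _ j).symm⟩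

/-- The monomial with exponents the type of `(I, J)` is the entry of the tensor power of the
generic matrix. -/
theorem prod_X_eq_monomial (I J : ι → n) :
    ∏ j, (MvPolynomial.X (I j, J j) : MvPolynomial (n × n) ℂ) =
      MvPolynomial.monomial (∑ j, Finsupp.single (I j, J j) 1) 1 := by
  rw [MvPolynomial.monomial_sum_one]
  rfl

/-- A matrix that commutes with the tensor powers of all matrices commutes with every matrix that
is invariant under permutations of the tensor factors. -/
theorem commute_of_commute_tensorPower [DecidableEq ι] [Fintype n] (T : Matrix (ι → n) (ι → n) ℂ)
    (hT : ∀ I J, ∑ K, MvPolynomial.C (T I K) * ∏ j, MvPolynomial.X (K j, J j) =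
      ∑ K, MvPolynomial.C (T K J) * ∏ j, (MvPolynomial.X (I j, K j) : MvPolynomial (n × n) ℂ))
    (B : Matrix (ι → n) (ι → n) ℂ)
    (hB : ∀ (σ : Equiv.Perm ι) I J, B (I ∘ σ) (J ∘ σ) = B I J) : T * B = B * T := by
  -- The monomial of an entry of the generic tensor power determines (I, J) up to simultaneous
  -- permutation, so B descends to a function of monomials. The default 0 on other monomials plays
  -- no role.
  let τ : (ι → n) × (ι → n) → (n × n →₀ ℕ) := fun p => ∑ j, Finsupp.single (p.1 j, p.2 j) 1
  let b : (n × n →₀ ℕ) → ℂ := Function.extend τ (fun p => B p.1 p.2) fun _ => 0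
  have hb : ∀ I J, b (τ (I, J)) = B I J := fun I J => by
    refine Function.FactorsThrough.extend_apply ?_ _ (I, J)
    rintro ⟨I₁, J₁⟩ ⟨I₂, J₂⟩ h12
    classical
    obtain ⟨σ, hσ⟩ := exists_perm_of_sum_single_eq h12
    have h1 : I₂ = I₁ ∘ σ := funext fun j => congrArg Prod.fst (congrFun hσ j)
    have h2 : J₂ = J₁ ∘ σ := funext fun j => congrArg Prod.snd (congrFun hσ j)
    simp only
    rw [h1, h2, hB]
  -- This functional turns the generic tensor power into B, entry by entry.
  let L : MvPolynomial (n × n) ℂ →ₗ[ℂ] ℂ := (MvPolynomial.basisMonomials (n × n) ℂ).constr ℂ b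
  have hL : ∀ (c : ℂ) I J, L (MvPolynomial.C c * ∏ j, MvPolynomial.X (I j, J j)) = c * B I J := by
    intro c I J
    rw [prod_X_eq_monomial, ← MvPolynomial.smul_eq_C_mul, map_smul, ← hb I J, smul_eq_mul]
    congr 1
    exact (MvPolynomial.basisMonomials (n × n) ℂ).constr_basis ℂ b (τ (I, J))
  ext I J
  have := congrArg L (hT I J)
  simp only [map_sum, hL] at this
  rw [mul_apply, mul_apply, this]
  exact Finset.sum_congr rfl fun _ _ => mul_comm _ _

/-- A matrix that commutes with the tensor powers of all matrices is a combination of permutations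
of the tensor factors. -/
theorem exists_eq_sum_perm_of_commute_tensorPower [DecidableEq ι] [Fintype n] [DecidableEq n]
    (T : Matrix (ι → n) (ι → n) ℂ)
    (hT : ∀ I J, ∑ K, MvPolynomial.C (T I K) * ∏ j, MvPolynomial.X (K j, J j) =
      ∑ K, MvPolynomial.C (T K J) * ∏ j, (MvPolynomial.X (I j, K j) : MvPolynomial (n × n) ℂ)) :
    ∃ c : Equiv.Perm ι → ℂ, ∀ I J, T I J = ∑ σ, c σ * if I ∘ σ = J then 1 else 0 := by
  let _ : MulAction (Equiv.Perm ι) (ι → n) := arrowAction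
  obtain ⟨c, hc⟩ := exists_eq_sum_permutation (G := Equiv.Perm ι) T fun B hB =>
    commute_of_commute_tensorPower T hT B fun σ I J => by
      have hσ : ∀ I : ι → n, σ⁻¹ • I = I ∘ σ := fun I => funext fun j =>
        congrArg I (by simp)
      rw [← hσ, ← hσ, hB]
  refine ⟨c, fun I J => (hc I J).trans (Finset.sum_congr rfl fun σ _ => ?_)⟩
  congr 2
  rw [← inv_smul_eq_iff]
  simp
  rfl

end TensorPower

/-! ### Gram matrices and dual families. -/

section DualBasis

variable {n : Type*} [Fintype n] [DecidableEq n]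

/-- The transposed Gram matrix of a nondegenerate form is invertible. -/
theorem isUnit_det_gram (h : V →ₗ[ℂ] V →ₗ⋆[ℂ] ℂ) (hnondeg : h.Nondegenerate)
    (b : Module.Basis n ℂ V) : IsUnit (Matrix.of fun i j => h (b j) (b i)).det := by
  rw [isUnit_iff_ne_zero]
  intro h0
  obtain ⟨c, hc0, hc⟩ := exists_mulVec_eq_zero_iff.2 h0
  apply hc0
  -- A kernel vector of the matrix gives a vector orthogonal to the whole basis.
  have hz : ∑ j, c j • b j = 0 := by
    refine hnondeg.1 _ fun y => ?_
    have hflip : ∀ i, h (∑ j, c j • b j) (b i) = 0 := fun i => by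
      have := congrFun hc i
      simp only [mulVec, dotProduct, of_apply, Pi.zero_apply] at this
      simp only [map_sum, LinearMap.sum_apply, map_smul, LinearMap.smul_apply, smul_eq_mul]
      rw [← this]
      exact Finset.sum_congr rfl fun _ _ => mul_comm _ _
    have : h (∑ j, c j • b j) = 0 := b.ext fun i => by rw [hflip, LinearMap.zero_apply]
    rw [this, LinearMap.zero_apply]
  exact funext fun i => Fintype.linearIndependent_iff.1 b.linearIndependent c hz i

/-- A basis has a dual family with respect to a nondegenerate form. -/
theorem exists_dualFamily (h : V →ₗ[ℂ] V →ₗ⋆[ℂ] ℂ) (hnondeg : h.Nondegenerate)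
    (b : Module.Basis n ℂ V) :
    ∃ b' : n → V, ∀ i j, h (b i) (b' j) = if i = j then 1 else 0 := by
  obtain ⟨M, hM⟩ : ∃ M : Matrix n n ℂ, M = Matrix.of fun i j => h (b j) (b i) := ⟨_, rfl⟩
  have hu : IsUnit M.det := hM ▸ isUnit_det_gram h hnondeg b
  -- The conjugate cancels the one from the second variable of h, leaving M⁻¹ M = 1.
  refine ⟨fun j => ∑ k, conj (M⁻¹ j k) • b k, fun i j => ?_⟩
  have := congrFun (congrFun (nonsing_inv_mul _ hu) j) i
  rw [mul_apply, one_apply] at this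
  simp only [map_sum, map_smulₛₗ, smul_eq_mul, Complex.conj_conj]
  rw [if_congr eq_comm rfl rfl, ← this]
  refine Finset.sum_congr rfl fun k _ => ?_
  rw [hM]
  rfl

theorem sum_form_smul_basis {h : V →ₗ[ℂ] V →ₗ⋆[ℂ] ℂ} {b : Module.Basis n ℂ V} {b' : n → V}
    (hb : ∀ i j, h (b i) (b' j) = if i = j then 1 else 0) (v : V) :
    ∑ k, h v (b' k) • b k = v := by
  have : ∀ k, h v (b' k) = b.repr v k := fun k => by
    conv_lhs => rw [← b.sum_repr v]
    simp only [map_sum, LinearMap.sum_apply, map_smul, LinearMap.smul_apply, hb, smul_eq_mul,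
      mul_ite, mul_one, mul_zero, Finset.sum_ite_eq', Finset.mem_univ, if_true]
  simp only [this, b.sum_repr]

/-- The difference of the two sides is orthogonal to every b i, so nondegeneracy kills it; `b'` need
not be known to be a basis. -/
theorem sum_conj_form_smul_dual {h : V →ₗ[ℂ] V →ₗ⋆[ℂ] ℂ} (hnondeg : h.Nondegenerate)
    {b : Module.Basis n ℂ V} {b' : n → V}
    (hb : ∀ i j, h (b i) (b' j) = if i = j then 1 else 0) (w : V) :
    ∑ k, conj (h (b k) w) • b' k = w := by
  refine sub_eq_zero.1 (hnondeg.2 _ fun x => ?_)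
  rw [← sum_form_smul_basis hb x]
  simp only [map_sum, LinearMap.sum_apply, map_smul, LinearMap.smul_apply]
  refine Finset.sum_eq_zero fun i _ => ?_
  simp [hb]

/-- A matrix that is unitary for the Gram matrix of `h` acts on `V` as an element of `U(V, h)`. -/
theorem exists_unitaryGroup_of_gram {h : V →ₗ[ℂ] V →ₗ⋆[ℂ] ℂ} (hnondeg : h.Nondegenerate)
    (b : Module.Basis n ℂ V) {g : Matrix n n ℂ}
    (hg : gᴴ * (Matrix.of fun i j => h (b j) (b i)) * g = Matrix.of fun i j => h (b j) (b i)) :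
    ∃ u ∈ unitaryGroup h, ∀ j, u (b j) = ∑ i, g i j • b i := by
  have hu := isUnit_det_gram h hnondeg b
  have hgu : IsUnit g.det := by
    rw [← hg, det_mul] at hu
    exact isUnit_of_mul_isUnit_right hu
  have hbasis : ∀ j, toLinearEquiv b g hgu (b j) = ∑ i, g i j • b i := toLin_self b b g
  refine ⟨toLinearEquiv b g hgu, fun v w => ?_, hbasis⟩
  have hb : ∀ i j, h (toLinearEquiv b g hgu (b i)) (toLinearEquiv b g hgu (b j)) = h (b i) (b j) := by
    intro i j
    have := congrFun (congrFun hg j) i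
    rw [of_apply] at this
    rw [hbasis, hbasis, ← this]
    simp only [mul_apply, map_sum, LinearMap.sum_apply, map_smul, LinearMap.smul_apply, map_smulₛₗ,
      conjTranspose_apply, of_apply, smul_eq_mul, Finset.sum_mul, Finset.mul_sum]
    rw [Finset.sum_comm]
    refine Finset.sum_congr rfl fun k _ => Finset.sum_congr rfl fun l _ => ?_
    simp
    ring
  have hvw : ∀ v j, h (toLinearEquiv b g hgu v) (toLinearEquiv b g hgu (b j)) = h v (b j) := by
    intro v j
    rw [← b.sum_repr v]
    simp only [map_sum, LinearMap.sum_apply, map_smul, LinearMap.smul_apply, hb]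
  rw [← b.sum_repr w]
  simp only [map_sum, map_smulₛₗ, hvw, RingHom.id_apply]

end DualBasis

/-! ### Invariants with equally many linear and conjugate-linear slots. -/

section SesquilinearInvariants

variable {ι : Type*} [Fintype ι] [DecidableEq ι]

/-- An invariant map that is complex-linear in the arguments `inl j` and conjugate-linear in the
arguments `inr j` is a combination of the products of `h (v (inl j)) (v (inr (σ j)))`. -/
theorem exists_eq_sum_prod_form [FiniteDimensional ℂ V] (h : V →ₗ[ℂ] V →ₗ⋆[ℂ] ℂ)
    (hherm : ∀ v w : V, h v w = conj (h w v)) (hnondeg : h.Nondegenerate)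
    (F : MultilinearMap ℝ (fun _ : ι ⊕ ι => V) ℂ)
    (hF : ∀ (a a' : ι → ℂ) (v w : ι → V),
      F (Sum.elim (fun j => a j • v j) (fun j => a' j • w j)) =
        (∏ j, a j) * (∏ j, conj (a' j)) * F (Sum.elim v w))
    (hinv : ∀ g ∈ unitaryGroup h, ∀ v, F (fun k => g (v k)) = F v) :
    ∃ c : Equiv.Perm ι → ℂ, ∀ v,
      F v = ∑ σ, c σ * ∏ j, h (v (Sum.inl j)) (v (Sum.inr (σ j))) := by
  let b := Module.finBasis ℂ V
  obtain ⟨b', hb⟩ := exists_dualFamily h hnondeg b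
  have hFl : ∀ (α : ι → Fin (Module.finrank ℂ V) → ℂ) (w : ι → V),
      F (Sum.elim (fun j => ∑ k, α j k • b k) w) =
        ∑ I : ι → Fin (Module.finrank ℂ V), (∏ j, α j (I j)) * F (Sum.elim (fun j => b (I j)) w) := by
    intro α w
    rw [← MultilinearMap.currySum_apply', MultilinearMap.map_sum, _root_.sum_apply]
    refine Finset.sum_congr rfl fun I _ => ?_
    have := hF (fun j => α j (I j)) 1 (fun j => b (I j)) w
    simpa using this
  have hFr : ∀ (β : ι → Fin (Module.finrank ℂ V) → ℂ) (v : ι → V),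
      F (Sum.elim v (fun j => ∑ k, conj (β j k) • b' k)) =
        ∑ J : ι → Fin (Module.finrank ℂ V), (∏ j, β j (J j)) *
          F (Sum.elim v (fun j => b' (J j))) := by
    intro β v
    rw [← MultilinearMap.currySum_apply', MultilinearMap.map_sum]
    refine Finset.sum_congr rfl fun J _ => ?_
    have := hF 1 (fun j => conj (β j (J j))) v (fun j => b' (J j))
    simpa using this
  let T : Matrix (ι → Fin (Module.finrank ℂ V)) (ι → Fin (Module.finrank ℂ V)) ℂ :=
    Matrix.of fun J I => F (Sum.elim (fun j => b (I j)) (fun j => b' (J j)))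
  have hH : (Matrix.of fun i j => h (b j) (b i)).IsHermitian := by
    ext i j
    rw [conjTranspose_apply, of_apply, of_apply, hherm]
    simp
  have hT : ∀ J I, ∑ K, MvPolynomial.C (T J K) * ∏ j, MvPolynomial.X (K j, I j) =
      ∑ K, MvPolynomial.C (T K I) * ∏ j, (MvPolynomial.X (J j, K j) : MvPolynomial _ ℂ) := by
    intro J I
    have hom : ∀ J I : ι → Fin (Module.finrank ℂ V),
        (∏ j, (MvPolynomial.X (J j, I j) : MvPolynomial _ ℂ)).IsHomogeneous (Fintype.card ι) := by
      intro J I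
      have := MvPolynomial.IsHomogeneous.prod Finset.univ
        (fun j => (MvPolynomial.X (J j, I j) : MvPolynomial _ ℂ)) (fun _ => 1)
        fun j _ => MvPolynomial.isHomogeneous_X ℂ _
      simpa using this
    refine sub_eq_zero.1 (eq_zero_of_forall_unitary_eval_eq_zero hH (isUnit_det_gram h hnondeg b)
      (d := Fintype.card ι) (MvPolynomial.IsHomogeneous.sub ?_ ?_) fun g hg => ?_)
    · exact MvPolynomial.IsHomogeneous.sum _ _ _ fun K _ => (hom _ _).C_mul _
    · exact MvPolynomial.IsHomogeneous.sum _ _ _ fun K _ => (hom _ _).C_mul _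
    obtain ⟨u, hu, hub⟩ := exists_unitaryGroup_of_gram hnondeg b hg
    have hub' : ∀ l, u⁻¹ (b' l) = ∑ k, conj (g l k) • b' k := fun l => by
      rw [← sum_conj_form_smul_dual hnondeg hb (u⁻¹ (b' l))]
      refine Finset.sum_congr rfl fun k _ => ?_
      have h1 : u (u⁻¹ (b' l)) = b' l := by
        rw [← LinearEquiv.mul_apply, mul_inv_cancel, LinearEquiv.coe_one, id]
      have h2 : h (b k) (u⁻¹ (b' l)) = g l k := by
        rw [← hu, h1, hub]
        simp [hb]
      rw [h2]
    have e1 := hFl (fun j k => g k (I j)) (fun j => b' (J j))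
    have e2 := hFr (fun j k => g (J j) k) (fun j => b (I j))
    simp only [← hub, ← hub'] at e1 e2
    -- F(u b_I, b'_J) = F(b_I, u⁻¹ b'_J): expanded on both sides, this is the commutation of T with
    -- the tensor power of g.
    have e3 := hinv u⁻¹ ((unitaryGroup h).inv_mem hu)
      (Sum.elim (fun j => u (b (I j))) (fun j => b' (J j)))
    have e4 : (fun k => u⁻¹ ((Sum.elim (fun j => u (b (I j))) (fun j => b' (J j)) : ι ⊕ ι → V) k)) =
        Sum.elim (fun j => b (I j)) (fun j => u⁻¹ (b' (J j))) := by
      funext k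
      rcases k with j | j
      · change u⁻¹ (u (b (I j))) = b (I j)
        rw [← LinearEquiv.mul_apply, inv_mul_cancel, LinearEquiv.coe_one, id]
      · rfl
    rw [e4, e1, e2] at e3
    simp only [map_sub, map_sum, map_mul, map_prod, MvPolynomial.eval_C, MvPolynomial.eval_X]
    rw [sub_eq_zero]
    simp only [mul_comm (T _ _)]
    exact e3.symm
  obtain ⟨c, hc⟩ := exists_eq_sum_perm_of_commute_tensorPower T hT
  refine ⟨c, fun v => ?_⟩
  have e0 : v = Sum.elim (fun j => ∑ k, h (v (Sum.inl j)) (b' k) • b k)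
      (fun j => ∑ k, conj (h (b k) (v (Sum.inr j))) • b' k) := by
    funext k
    rcases k with j | j
    · exact (sum_form_smul_basis hb _).symm
    · exact (sum_conj_form_smul_dual hnondeg hb _).symm
  have e1 : F v = ∑ I, (∏ j, h (v (Sum.inl j)) (b' (I j))) *
      ∑ J, (∏ j, h (b (J j)) (v (Sum.inr j))) * T J I := by
    conv_lhs => rw [e0]
    rw [hFl]
    simp only [hFr]
    rfl
  have e2 : ∀ σ : Equiv.Perm ι, ∏ j, h (v (Sum.inl j)) (v (Sum.inr (σ j))) =
      ∑ J : ι → Fin (Module.finrank ℂ V), (∏ j, h (v (Sum.inl j)) (b' (J (σ j)))) *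
        ∏ j, h (b (J j)) (v (Sum.inr j)) := by
    intro σ
    have : ∀ j, h (v (Sum.inl j)) (v (Sum.inr (σ j))) =
        ∑ k, h (v (Sum.inl j)) (b' k) * h (b k) (v (Sum.inr (σ j))) := fun j => by
      conv_lhs => rw [← sum_form_smul_basis hb (v (Sum.inl j))]
      simp
    simp only [this]
    rw [Fintype.prod_sum]
    -- Reindexing by J ↦ J ∘ σ.
    refine (Equiv.sum_comp (Equiv.arrowCongr σ.symm (Equiv.refl _)) _).symm.trans
      (Finset.sum_congr rfl fun J _ => ?_)
    rw [Finset.prod_mul_distrib]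
    congr 1
    exact Equiv.prod_comp σ fun j => h (b (J j)) (v (Sum.inr j))
  rw [e1]
  simp only [e2, hc, Finset.mul_sum]
  rw [Finset.sum_comm]
  conv_rhs => rw [Finset.sum_comm]
  refine Finset.sum_congr rfl fun J _ => ?_
  rw [Finset.sum_comm]
  refine Finset.sum_congr rfl fun σ _ => ?_
  rw [Finset.sum_eq_single (J ∘ σ)]
  · simp only [Function.comp_apply, if_true]
    ring
  · intro I _ hI
    simp [hI.symm]
  · exact fun hn => absurd (Finset.mem_univ _) hn

end SesquilinearInvariants

/-! ### Splitting into linear and conjugate-linear slots. -/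

section SlotDecomposition

variable {κ : Type*} [DecidableEq κ]

/-- The map `F` is complex-linear (for `ε = true`) or conjugate-linear (for `ε = false`) in the
argument `k`. -/
def IsHomogeneousAt (F : MultilinearMap ℝ (fun _ : κ => V) ℂ) (k : κ) (ε : Bool) : Prop :=
  ∀ v, F (Function.update v k (Complex.I • v k)) = (if ε then Complex.I else -Complex.I) * F v

/-- The identity (for `ε = true`) or the conjugation (for `ε = false`) of the complex numbers. -/
def conjIf (ε : Bool) : ℂ →+* ℂ := if ε then RingHom.id ℂ else starRingEnd ℂ

theorem IsHomogeneousAt.map_update_smul {F : MultilinearMap ℝ (fun _ : κ => V) ℂ} {k : κ}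
    {ε : Bool} (hF : IsHomogeneousAt F k ε) (a : ℂ) (v : κ → V) :
    F (Function.update v k (a • v k)) = conjIf ε a * F v := by
  have ha : a • v k = a.re • v k + a.im • (Complex.I • v k) := by
    conv_lhs => rw [← Complex.re_add_im a]
    rw [add_smul, mul_smul, Complex.coe_smul, Complex.coe_smul]
  rw [ha, F.map_update_add, F.map_update_smul, F.map_update_smul, hF, Function.update_eq_self,
    Complex.real_smul, Complex.real_smul]
  have hc : conjIf ε a = a.re + a.im * (if ε then Complex.I else -Complex.I) := by
    cases ε
    · apply Complex.ext <;> simp [conjIf]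
    · apply Complex.ext <;> simp [conjIf]
  rw [hc]
  ring

theorem map_smul_of_isHomogeneousAt [Fintype κ] {F : MultilinearMap ℝ (fun _ : κ => V) ℂ} {s : κ → Bool}
    (hF : ∀ k, IsHomogeneousAt F k (s k)) (a : κ → ℂ) (v : κ → V) :
    F (fun k => a k • v k) = (∏ k, conjIf (s k) (a k)) * F v := by
  have : ∀ S : Finset κ, F (S.piecewise (fun k => a k • v k) v) =
      (∏ k ∈ S, conjIf (s k) (a k)) * F v := by
    intro S
    induction S using Finset.induction_on with
    | empty => simp
    | insert k S hk ih =>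
      have := (hF k).map_update_smul (a k) (S.piecewise (fun k => a k • v k) v)
      rw [Finset.piecewise_eq_of_notMem _ _ _ hk] at this
      rw [Finset.piecewise_insert, this, ih, Finset.prod_insert hk, mul_assoc]
  simpa using this Finset.univ

/-- The map `F` with its argument `k` multiplied by the imaginary unit. -/
def rotateAt (k : κ) (F : MultilinearMap ℝ (fun _ : κ => V) ℂ) :
    MultilinearMap ℝ (fun _ : κ => V) ℂ :=
  F.compLinearMap (Function.update (fun _ => LinearMap.id) k (J V))

theorem rotateAt_apply (k : κ) (F : MultilinearMap ℝ (fun _ : κ => V) ℂ) (v : κ → V) :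
    rotateAt k F v = F (Function.update v k (Complex.I • v k)) := by
  rw [rotateAt, MultilinearMap.compLinearMap_apply]
  congr 1
  funext l
  rcases eq_or_ne l k with rfl | hl
  · simp [J]
  · simp [hl]

/-- The component of `F` that is complex-linear or conjugate-linear in the argument `k`. -/
def slotComponent (k : κ) (ε : Bool) (F : MultilinearMap ℝ (fun _ : κ => V) ℂ) :
    MultilinearMap ℝ (fun _ : κ => V) ℂ :=
  (1 / 2 : ℂ) • (F + (if ε then -Complex.I else Complex.I) • rotateAt k F)

theorem slotComponent_apply (k : κ) (ε : Bool) (F : MultilinearMap ℝ (fun _ : κ => V) ℂ)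
    (v : κ → V) : slotComponent k ε F v = 1 / 2 * (F v +
      (if ε then -Complex.I else Complex.I) * F (Function.update v k (Complex.I • v k))) := by
  rw [← rotateAt_apply]
  rfl

theorem slotComponent_add_slotComponent (k : κ) (F : MultilinearMap ℝ (fun _ : κ => V) ℂ) :
    slotComponent k true F + slotComponent k false F = F := by
  ext v
  rw [_root_.add_apply, slotComponent_apply, slotComponent_apply]
  simp only [if_true, Bool.false_eq_true, if_false]
  ring

/-- Rotating the slot twice is multiplication by −1, so the two components are eigenvectors of the
rotation, for i and −i. -/
theorem isHomogeneousAt_slotComponent (k : κ) (ε : Bool)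
    (F : MultilinearMap ℝ (fun _ : κ => V) ℂ) : IsHomogeneousAt (slotComponent k ε F) k ε := by
  intro v
  have hII : Complex.I • Complex.I • v k = (-1 : ℝ) • v k := by
    rw [smul_smul, Complex.I_mul_I, neg_smul, neg_smul, one_smul, one_smul]
  rw [slotComponent_apply, slotComponent_apply, Function.update_self, Function.update_idem, hII,
    F.map_update_smul, Function.update_eq_self, Complex.real_smul]
  cases ε
  · simp only [Bool.false_eq_true, if_false, Complex.ofReal_neg, Complex.ofReal_one]
    linear_combination (1 / 2 * F (Function.update v k (Complex.I • v k))) * Complex.I_mul_I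
  · simp only [if_true, Complex.ofReal_neg, Complex.ofReal_one]
    linear_combination (1 / 2 * F (Function.update v k (Complex.I • v k))) * Complex.I_mul_I

theorem IsHomogeneousAt.slotComponent {F : MultilinearMap ℝ (fun _ : κ => V) ℂ} {l : κ}
    {η : Bool} (hF : IsHomogeneousAt F l η) {k : κ} (hkl : l ≠ k) (ε : Bool) :
    IsHomogeneousAt (slotComponent k ε F) l η := by
  intro v
  have h2 := hF (Function.update v k (Complex.I • v k))
  rw [Function.update_of_ne hkl, Function.update_comm hkl.symm] at h2
  rw [slotComponent_apply, slotComponent_apply, hF, Function.update_of_ne hkl.symm, h2]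
  ring

theorem slotComponent_invariant {h : V →ₗ[ℂ] V →ₗ⋆[ℂ] ℂ}
    {F : MultilinearMap ℝ (fun _ : κ => V) ℂ}
    (hF : ∀ g ∈ unitaryGroup h, ∀ v, F (fun k => g (v k)) = F v) (k : κ) (ε : Bool) :
    ∀ g ∈ unitaryGroup h, ∀ v, slotComponent k ε F (fun k => g (v k)) = slotComponent k ε F v := by
  intro g hg v
  have : Function.update (fun l => g (v l)) k (Complex.I • g (v k)) =
      fun l => g (Function.update v k (Complex.I • v k) l) := by
    funext l
    rcases eq_or_ne l k with rfl | hl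
    · simp
    · simp [hl]
  rw [slotComponent_apply, slotComponent_apply, this, hF g hg, hF g hg]

/-- A property of invariant maps that is closed under addition holds as soon as it holds for the
maps that are complex-linear or conjugate-linear in every argument. -/
theorem induction_on_homogeneous [Fintype κ] {h : V →ₗ[ℂ] V →ₗ⋆[ℂ] ℂ}
    {P : MultilinearMap ℝ (fun _ : κ => V) ℂ → Prop} (hadd : ∀ F G, P F → P G → P (F + G))
    (hom : ∀ F : MultilinearMap ℝ (fun _ : κ => V) ℂ,
      (∀ g ∈ unitaryGroup h, ∀ v, F (fun k => g (v k)) = F v) →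
      ∀ s : κ → Bool, (∀ k, IsHomogeneousAt F k (s k)) → P F)
    (F : MultilinearMap ℝ (fun _ : κ => V) ℂ)
    (hF : ∀ g ∈ unitaryGroup h, ∀ v, F (fun k => g (v k)) = F v) : P F := by
  -- S is the set of slots still to be split; the values of s on S are irrelevant and are
  -- overwritten as slots leave S.
  have key : ∀ S : Finset κ, ∀ F : MultilinearMap ℝ (fun _ : κ => V) ℂ,
      (∀ g ∈ unitaryGroup h, ∀ v, F (fun k => g (v k)) = F v) →
      ∀ s : κ → Bool, (∀ k ∉ S, IsHomogeneousAt F k (s k)) → P F := by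
    intro S
    induction S using Finset.induction_on with
    | empty => exact fun F hF s hs => hom F hF s fun k => hs k (Finset.notMem_empty k)
    | insert k S hk ih =>
      intro F hF s hs
      have hcomp : ∀ ε, P (slotComponent k ε F) := fun ε => by
        refine ih _ (slotComponent_invariant hF k ε) (Function.update s k ε) fun l hl => ?_
        rcases eq_or_ne l k with rfl | hlk
        · rw [Function.update_self]
          exact isHomogeneousAt_slotComponent _ _ _
        · rw [Function.update_of_ne hlk]
          exact (hs l (by simp [hlk, hl])).slotComponent hlk ε
      rw [← slotComponent_add_slotComponent k F]
      exact hadd _ _ (hcomp _) (hcomp _)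
  exact key Finset.univ F hF (fun _ => true) fun k hk => absurd (Finset.mem_univ k) hk

/-- A nonzero invariant map has as many complex-linear arguments as conjugate-linear ones. -/
theorem card_linear_eq_card_conjLinear [Fintype κ] {h : V →ₗ[ℂ] V →ₗ⋆[ℂ] ℂ}
    {F : MultilinearMap ℝ (fun _ : κ => V) ℂ}
    (hF : ∀ g ∈ unitaryGroup h, ∀ v, F (fun k => g (v k)) = F v) (hF0 : F ≠ 0) {s : κ → Bool}
    (hs : ∀ k, IsHomogeneousAt F k (s k)) :
    Fintype.card {k // s k = true} = Fintype.card {k // ¬ s k = true} := by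
  -- Both cardinalities are less than N, so powers of a primitive N-th root of unity tell them
  -- apart.
  obtain ⟨N, hN⟩ : ∃ N, N = Fintype.card κ + 1 := ⟨_, rfl⟩
  have hprim := Complex.isPrimitiveRoot_exp N (by omega)
  obtain ⟨z, hz⟩ : ∃ z, z = Complex.exp (2 * Real.pi * Complex.I / N) := ⟨_, rfl⟩
  rw [← hz] at hprim
  have hnorm : ‖z‖ = 1 := hprim.norm'_eq_one (by omega)
  have hzz : z * conj z = 1 := by
    rw [Complex.mul_conj, Complex.normSq_eq_norm_sq, hnorm]
    simp
  have hz0 : z ≠ 0 := fun h0 => by simp [h0] at hzz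
  have hmem : LinearEquiv.smulOfNeZero ℂ V z hz0 ∈ unitaryGroup h := by
    intro v w
    change h (z • v) (z • w) = h v w
    simp only [map_smul, LinearMap.smul_apply, map_smulₛₗ, smul_smul]
    rw [mul_comm, hzz, one_smul]
  obtain ⟨v, hv⟩ : ∃ v, F v ≠ 0 := by
    by_contra! hcon
    exact hF0 (MultilinearMap.ext hcon)
  have h1 := hF _ hmem v
  change F (fun k => z • v k) = F v at h1
  rw [map_smul_of_isHomogeneousAt hs (fun _ => z) v, mul_eq_right₀ hv] at h1
  have h2 : ∀ k, conjIf (s k) z = if s k = true then z else conj z := fun k => by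
    cases s k <;> simp [conjIf]
  simp only [h2, Finset.prod_ite, Finset.prod_const, ← Fintype.card_subtype] at h1
  refine hprim.pow_inj (lt_of_le_of_lt (Fintype.card_subtype_le _) (by omega))
    (lt_of_le_of_lt (Fintype.card_subtype_le _) (by omega)) ?_
  calc z ^ Fintype.card {k // s k = true}
      = z ^ Fintype.card {k // s k = true} * (z * conj z) ^ Fintype.card {k // ¬ s k = true} := by
        rw [hzz, one_pow, mul_one]
    _ = z ^ Fintype.card {k // ¬ s k = true} := by
        rw [mul_pow, mul_left_comm, h1, mul_one]

end SlotDecomposition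

/-! ### From values of h to real pairing products. -/

section Pairings

/-- The form `h` in terms of its real part. -/
theorem form_eq_sum_realForm (h : V →ₗ[ℂ] V →ₗ⋆[ℂ] ℂ) (v w : V) :
    h v w = ∑ d : Fin 2, Complex.I ^ d.1 * (realForm h v ((J V ^ d.1) w) : ℂ) := by
  rw [Fin.sum_univ_two]
  have h0 : realForm h v w = (h v w).re := rfl
  have h1 : realForm h v (J V w) = (h v (Complex.I • w)).re := rfl
  -- h(v, iw) = −i h(v, w), whose real part is Im h(v, w).
  rw [map_smulₛₗ] at h1
  simp only [Fin.val_zero, Fin.val_one, pow_zero, pow_one, Module.End.one_apply, h0, h1]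
  apply Complex.ext <;> simp

/-- The bijection that enumerates the numbers below `2 * m` as even numbers and odd numbers. -/
theorem exists_evenOddEquiv (m : ℕ) : ∃ e : Fin m ⊕ Fin m ≃ Fin (2 * m),
    (∀ l : Fin m, e (Sum.inl l) = ⟨2 * l.1, by omega⟩) ∧
    ∀ l : Fin m, e (Sum.inr l) = ⟨2 * l.1 + 1, by omega⟩ := by
  let φ : Fin m ⊕ Fin m → Fin (2 * m) :=
    Sum.elim (fun l => ⟨2 * l.1, by omega⟩) (fun l => ⟨2 * l.1 + 1, by omega⟩)
  have hφ : Function.Bijective φ := by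
    rw [Fintype.bijective_iff_injective_and_card]
    refine ⟨?_, by simp; omega⟩
    rintro (⟨a, ha⟩ | ⟨a, ha⟩) (⟨b, hb⟩ | ⟨b, hb⟩) hab <;>
      simp only [φ, Sum.elim_inl, Sum.elim_inr, Fin.mk.injEq] at hab <;>
      first
      | omega
      | (congr; omega)
  exact ⟨Equiv.ofBijective φ hφ, fun _ => rfl, fun _ => rfl⟩

/-- A product of values of `h` at disjoint pairs of arguments is a complex combination of pairing
products. -/
theorem exists_prod_form_eq_sum_pairingProduct (h : V →ₗ[ℂ] V →ₗ⋆[ℂ] ℂ) {m : ℕ}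
    (e : Fin m ⊕ Fin m ≃ Fin (2 * m)) :
    ∃ ρ : Equiv.Perm (Fin (2 * m)), ∀ v : Fin (2 * m) → V,
      ∏ j, h (v (e (Sum.inl j))) (v (e (Sum.inr j))) =
        ∑ δ : Fin m → Fin 2, (∏ j, Complex.I ^ (δ j).1) * (pairingProduct h ρ δ v : ℂ) := by
  obtain ⟨e₀, hl, hr⟩ := exists_evenOddEquiv m
  -- This permutation sends the even index 2l to `e (inl l)` and the odd index 2l + 1 to `e (inr
  -- l)`.
  refine ⟨e₀.symm.trans e, fun v => ?_⟩
  simp only [form_eq_sum_realForm h]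
  rw [Fintype.prod_sum]
  refine Finset.sum_congr rfl fun δ _ => ?_
  rw [Finset.prod_mul_distrib, pairingProduct_apply, Complex.ofReal_prod]
  simp only [← hl, ← hr, Equiv.trans_apply, Equiv.symm_apply_apply]

/-- Unitary maps are complex-linear, so they commute with J, and they preserve Re h. -/
theorem pairingProduct_mem_invariantForms (h : V →ₗ[ℂ] V →ₗ⋆[ℂ] ℂ) {m : ℕ}
    (σ : Equiv.Perm (Fin (2 * m))) (δ : Fin m → Fin 2) :
    pairingProduct h σ δ ∈ invariantForms h (2 * m) := by
  intro g hg v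
  have hJ : ∀ (d : ℕ) w, (J V ^ d) (g w) = g ((J V ^ d) w) := by
    intro d w
    induction d with
    | zero => rfl
    | succ d ih =>
      rw [pow_succ', Module.End.mul_apply, Module.End.mul_apply, ih]
      exact (map_smul g Complex.I _).symm
  have hre : ∀ v w, realForm h (g v) (g w) = realForm h v w := fun v w =>
    congrArg Complex.re (hg v w)
  simp only [pairingProduct_apply, hJ, hre]

/-- The real part of an invariant map that is complex-linear or conjugate-linear in every argument
is a combination of pairing products. -/
theorem re_mem_span_of_isHomogeneousAt [FiniteDimensional ℂ V] (h : V →ₗ[ℂ] V →ₗ⋆[ℂ] ℂ)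
    (hherm : ∀ v w : V, h v w = conj (h w v)) (hnondeg : h.Nondegenerate) {m : ℕ}
    (F : MultilinearMap ℝ (fun _ : Fin (2 * m) => V) ℂ)
    (hF : ∀ g ∈ unitaryGroup h, ∀ v, F (fun k => g (v k)) = F v) (s : Fin (2 * m) → Bool)
    (hs : ∀ k, IsHomogeneousAt F k (s k)) :
    Complex.reLm.compMultilinearMap F ∈ Submodule.span ℝ (Set.range
      fun p : Equiv.Perm (Fin (2 * m)) × (Fin m → Fin 2) => pairingProduct h p.1 p.2) := by
  -- The slot count needs a nonzero map.
  by_cases hF0 : F = 0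
  · subst hF0
    convert Submodule.zero_mem _
    ext v
    simp
  have hcard := card_linear_eq_card_conjLinear hF hF0 hs
  have hsum := Fintype.card_congr (Equiv.sumCompl fun k => s k = true)
  rw [Fintype.card_sum, Fintype.card_fin] at hsum
  let e₁ : Fin m ≃ {k // s k = true} := (Fintype.equivFinOfCardEq (by omega)).symm
  let e₂ : Fin m ≃ {k // ¬ s k = true} := (Fintype.equivFinOfCardEq (by omega)).symm
  let e : Fin m ⊕ Fin m ≃ Fin (2 * m) :=
    (Equiv.sumCongr e₁ e₂).trans (Equiv.sumCompl fun k => s k = true)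
  have hel : ∀ j, s (e (Sum.inl j)) = true := fun j => (e₁ j).2
  have her : ∀ j, s (e (Sum.inr j)) = false := fun j =>
    Bool.eq_false_iff.2 (e₂ j).2
  obtain ⟨c, hc⟩ := exists_eq_sum_prod_form h hherm hnondeg (F.domDomCongr e.symm)
    (fun a a' v w => by
      rw [MultilinearMap.domDomCongr_apply, MultilinearMap.domDomCongr_apply]
      have := map_smul_of_isHomogeneousAt hs (fun k => Sum.elim a a' (e.symm k))
        (fun k => Sum.elim v w (e.symm k))
      rw [← Equiv.prod_comp e, Fintype.prod_sum_type] at this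
      simp only [Equiv.symm_apply_apply, Sum.elim_inl, Sum.elim_inr, hel, her] at this
      rw [show (∏ j, a j) = ∏ j, conjIf true (a j) from rfl,
        show (∏ j, conj (a' j)) = ∏ j, conjIf false (a' j) from rfl, ← this]
      congr 1
      funext k
      rcases e.symm k with j | j <;> rfl)
    (fun g hg v => hF g hg _)
  choose ρ hρ using fun σ : Equiv.Perm (Fin m) =>
    exists_prod_form_eq_sum_pairingProduct h ((Equiv.sumCongr (Equiv.refl _) σ).trans e)
  -- Pairing products are real, so taking the real part of F only affects the coefficients.
  have hexp : Complex.reLm.compMultilinearMap F = ∑ σ, ∑ δ : Fin m → Fin 2,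
      (c σ * ∏ j, Complex.I ^ (δ j).1).re • pairingProduct h (ρ σ) δ := by
    ext v
    have h1 : F v = ∑ σ, ∑ δ : Fin m → Fin 2,
        (c σ * ∏ j, Complex.I ^ (δ j).1) * (pairingProduct h (ρ σ) δ v : ℂ) := by
      have := hc (v ∘ e)
      have hve : (fun i => (v ∘ e) (e.symm i)) = v := funext fun i =>
        congrArg v (e.apply_symm_apply i)
      rw [MultilinearMap.domDomCongr_apply, hve] at this
      rw [this]
      refine Finset.sum_congr rfl fun σ _ => ?_
      refine (congrArg (c σ * ·) (hρ σ v)).trans ?_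
      simp only [Finset.mul_sum, mul_assoc]
    change (F v).re = _
    rw [h1]
    simp only [Complex.re_sum, Complex.re_mul_ofReal, _root_.sum_apply, _root_.smul_apply,
      smul_eq_mul]
  rw [hexp]
  exact Submodule.sum_mem _ fun σ _ => Submodule.sum_mem _ fun δ _ =>
    Submodule.smul_mem _ _ (Submodule.subset_span ⟨(ρ σ, δ), rfl⟩)

/-- The slot induction applies to f viewed as complex-valued, since taking real parts is additive
and gives back f. -/
theorem mem_span_pairingProduct [FiniteDimensional ℂ V] (h : V →ₗ[ℂ] V →ₗ⋆[ℂ] ℂ)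
    (hherm : ∀ v w : V, h v w = conj (h w v)) (hnondeg : h.Nondegenerate) {m : ℕ}
    {f : MultilinearMap ℝ (fun _ : Fin (2 * m) => V) ℝ} (hf : f ∈ invariantForms h (2 * m)) :
    f ∈ Submodule.span ℝ (Set.range
      fun p : Equiv.Perm (Fin (2 * m)) × (Fin m → Fin 2) => pairingProduct h p.1 p.2) :=
  induction_on_homogeneous (h := h)
    (P := fun F => Complex.reLm.compMultilinearMap F ∈ Submodule.span ℝ (Set.range
      fun p : Equiv.Perm (Fin (2 * m)) × (Fin m → Fin 2) => pairingProduct h p.1 p.2))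
    (fun _ _ hF hG => Submodule.add_mem _ hF hG)
    (re_mem_span_of_isHomogeneousAt h hherm hnondeg)
    (Complex.ofRealAm.toLinearMap.compMultilinearMap f)
    fun g hg v => congrArg Complex.ofReal (hf g hg v)

theorem even_of_mem_invariantForms {h : V →ₗ[ℂ] V →ₗ⋆[ℂ] ℂ} {r : ℕ}
    {f : MultilinearMap ℝ (fun _ : Fin r => V) ℝ} (hf : f ∈ invariantForms h r) (hf0 : f ≠ 0) :
    Even r := by
  by_contra hr
  refine hf0 (MultilinearMap.ext fun v => ?_)
  have hneg : LinearEquiv.neg ℂ ∈ unitaryGroup h := fun v w => by simp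
  have h1 := hf _ hneg v
  have h2 := f.map_smul_univ (fun _ => (-1 : ℝ)) v
  simp only [Finset.prod_const, Finset.card_univ, Fintype.card_fin,
    (Nat.not_even_iff_odd.1 hr).neg_one_pow, neg_smul, one_smul] at h2
  simp only [LinearEquiv.neg_apply] at h1
  rw [_root_.zero_apply]
  linarith

end Pairings

end UnitaryInvariants

end

theorem theorem2p1 {V : Type*} [AddCommGroup V] [Module ℂ V] [FiniteDimensional ℂ V]
    (h : V →ₗ[ℂ] V →ₗ⋆[ℂ] ℂ) (hherm : ∀ v w : V, h v w = conj (h w v))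
    (hnondeg : h.Nondegenerate) :
    (∀ (r : ℕ) (f : MultilinearMap ℝ (fun _ : Fin r => V) ℝ),
      f ∈ UnitaryInvariants.invariantForms h r → f ≠ 0 → Even r) ∧
    (∀ m : ℕ, UnitaryInvariants.invariantForms h (2 * m) =
      Submodule.span ℝ (Set.range fun p : Equiv.Perm (Fin (2 * m)) × (Fin m → Fin 2) =>
        UnitaryInvariants.pairingProduct h p.1 p.2)) := by
  refine ⟨fun r f hf hf0 => UnitaryInvariants.even_of_mem_invariantForms hf hf0,
    fun m => le_antisymm
      (fun f hf => UnitaryInvariants.mem_span_pairingProduct h hherm hnondeg hf)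
      (Submodule.span_le.2 ?_)⟩
  rintro _ ⟨p, rfl⟩
  exact UnitaryInvariants.pairingProduct_mem_invariantForms h p.1 p.2
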